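/- Let $d\ge 1$, let $\Omega\subset\mathbb R^d$ be a bounded domain, and let $a>0$, $b\in\mathbb R\setminus\{0\}$. Let $\Delta$ be the Dirichlet Laplacian in $L^2(\Omega;\mathbb R)$, that is, $u\in H_0^1(\Omega)$ and $\Delta u\in L^2(\Omega)$ in the weak sense; let $\lambda_1\le\lambda_2\le\cdots\to+\infty$ be the eigenvalues of $-\Delta$, counted with multiplicity, and $\{e_i\}_{i\ge1}$ an orthonormal basis of $L^2(\Omega;\mathbb R)$ of corresponding eigenfunctions. For $\lambda>\lambda_1$ put $k_\lambda:=\max\{i\ge 1:\lambda_i\le\lambda\}$. Let $\{e^{\mathcal At}\}_{t\ge0}$ be the strongly continuous semigroup on $L^2(\Omega;\mathbb R^2)$ generated by $$\mathcal A=\begin{pmatrix} a\Delta & -b\Delta\\ b\Delta & a\Delta\end{pmatrix},$$ and let $B=(1,0)$, i.e. $Bz=z_1$ for $z=(z_1,z_2)^\top$. For every $D>0$ there is a constant $M>0$, depending only on $\Omega,a,b,D$, with the following property. Let $T>0$, let $E\subset(0,T)$ be a Lebesgue measurable set of positive measure, and let $\{\mathcal D_t\}_{t\in(0,T)}$ be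 a family of subsets of $\Omega$ such that (a) $\mathcal D_t$ is Lebesgue measurable for a.e. $t\in(0,T)$; (b) for every $f\in L^1(\Omega\times(0,T))$ the function $t\mapsto\int_\Omega\chi_{\mathcal D_t}(x)|f(x,t)|\,dx$ is integrable over $(0,T)$; (c) for a.e. $t\in E$, for all $\lambda>\lambda_1$ and all $\{a_i\}_{i=1}^{k_\lambda}\subset\mathbb R$, $$\sum_{i=1}^{k_\lambda}|a_i|^2\le D e^{D\sqrt\lambda}\,\Big\|\chi_{\mathcal D_t}\sum_{i=1}^{k_\lambda}a_ie_i\Big\|_{L^1(\Omega;\mathbb R)}^2 .$$ Then for all $\theta\in(0,1)$, all $0<S_1<S_2\le T$ with $|E\cap[S_1,S_2]|>0$, and all $z\in L^2(\Omega;\mathbb R^2)$, the function $t\mapsto\chi_E(t)\|\chi_{\mathcal D_t}Be^{\mathcal At}z\|_{L^1(\Omega;\mathbb R)}$ is integrable over $(S_1,S_2)$ and $$\|e^{\mathcal AS_2}z\|_{L^2(\Omega;\mathbb R^2)}\le \frac{M e^{M\left(\frac{S_2}{1-\theta}+\frac1{\theta S_1}\right)}}{|E\cap[S_1,S_2]|^3}\left(\frac1{|E\cap[S_1,S_2]|}\int_{S_1}^{S_2}\chi_E(t)\,\|\chi_{\mathcal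 D_t}Be^{\mathcal At}z\|_{L^1(\Omega;\mathbb R)}\,dt\right)^{1-\theta}\|z\|_{L^2(\Omega;\mathbb R^2)}^{\theta}.$$ -/

import Mathlib

open MeasureTheory Set Filter Topology
open scoped ContDiff

noncomputable section

/-- The real Hilbert space `L²(Ω; V)` for `Ω ⊆ ℝᵈ` with Lebesgue measure. -/
abbrev L2 {d : ℕ} (Ω : Set (EuclideanSpace ℝ (Fin d))) (V : Type*) [NormedAddCommGroup V] :
    Type _ :=
  Lp V 2 (volume.restrict Ω)

/-- The pairs `(φ, ∇φ)`, `φ ∈ C_c^∞(Ω)`, as a subset of `L²(Ω) × L²(Ω; ℝᵈ)`. -/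
def testGraph {d : ℕ} (Ω : Set (EuclideanSpace ℝ (Fin d))) :
    Set (L2 Ω ℝ × L2 Ω (EuclideanSpace ℝ (Fin d))) :=
  {p | ∃ φ : EuclideanSpace ℝ (Fin d) → ℝ, ContDiff ℝ ∞ φ ∧ HasCompactSupport φ ∧
    tsupport φ ⊆ Ω ∧ p.1 =ᵐ[volume.restrict Ω] φ ∧ p.2 =ᵐ[volume.restrict Ω] gradient φ}

/-- `u ∈ H₀¹(Ω)` with weak gradient `G`: the pair `(u, G)` is a limit in `L²` of pairs `(φ, ∇φ)`
with `φ ∈ C_c^∞(Ω)`, i.e. `u` lies in the closure of `C_c^∞(Ω)` for the `H¹` norm. -/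
def HasH10Gradient {d : ℕ} (Ω : Set (EuclideanSpace ℝ (Fin d))) (u : L2 Ω ℝ)
    (G : L2 Ω (EuclideanSpace ℝ (Fin d))) : Prop :=
  (u, G) ∈ closure (testGraph Ω)

/-- The graph of the Dirichlet Laplacian in `L²(Ω)`: `u ∈ H₀¹(Ω)`, and `Δu = f ∈ L²(Ω)` weakly,
i.e. `∫_Ω ∇u · ∇v = -∫_Ω f v` for all `v ∈ H₀¹(Ω)`. -/
def IsDirichletLaplacian {d : ℕ} (Ω : Set (EuclideanSpace ℝ (Fin d))) (u f : L2 Ω ℝ) : Prop :=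
  ∃ G, HasH10Gradient Ω u G ∧
    ∀ v Gv, HasH10Gradient Ω v Gv → inner ℝ G Gv = -inner ℝ f v

/-- `(e i)` is an orthonormal basis of `L²(Ω)` made of eigenfunctions of the Dirichlet operator
`-Δ`, with eigenvalues `lam i` in nondecreasing order (indices start at `0`). -/
structure IsDirichletEigenbasis {d : ℕ} (Ω : Set (EuclideanSpace ℝ (Fin d))) (lam : ℕ → ℝ)
    (e : HilbertBasis ℕ ℝ (L2 Ω ℝ)) : Prop where
  monotone : Monotone lam
  eigen : ∀ i, IsDirichletLaplacian Ω (e i) (-(lam i • e i))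

/-- The `i`-th component of `z ∈ L²(Ω; ℝ²)`. For `i = 0` this is `B z`, where `B = (1, 0)`. -/
def component {d : ℕ} {Ω : Set (EuclideanSpace ℝ (Fin d))} (i : Fin 2)
    (z : L2 Ω (EuclideanSpace ℝ (Fin 2))) : L2 Ω ℝ :=
  (EuclideanSpace.proj i : EuclideanSpace ℝ (Fin 2) →L[ℝ] ℝ).compLp z

/-- The graph of the operator `𝒜 = (aΔ, -bΔ; bΔ, aΔ)` in `L²(Ω; ℝ²)` with homogeneous Dirichlet
conditions: `𝒜 z = w`. -/
def CoupledOperator {d : ℕ} (Ω : Set (EuclideanSpace ℝ (Fin d))) (a b : ℝ)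
    (z w : L2 Ω (EuclideanSpace ℝ (Fin 2))) : Prop :=
  ∃ f₁ f₂ : L2 Ω ℝ,
    IsDirichletLaplacian Ω (component 0 z) f₁ ∧ IsDirichletLaplacian Ω (component 1 z) f₂ ∧
    component 0 w = a • f₁ - b • f₂ ∧ component 1 w = b • f₁ + a • f₂

/-- `(S t)`, `t ≥ 0`, is the strongly continuous semigroup on `H` whose infinitesimal generator is
the operator with graph `Gen` (values of `S` at negative times are irrelevant). -/
structure IsSemigroupGeneratedBy {H : Type*} [NormedAddCommGroup H] [NormedSpace ℝ H]
    (S : ℝ → H →L[ℝ] H) (Gen : H → H → Prop) : Prop where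
  at_zero : S 0 = ContinuousLinearMap.id ℝ H
  comp : ∀ s t, 0 ≤ s → 0 ≤ t → S (s + t) = (S s).comp (S t)
  continuousOn : ∀ z, ContinuousOn (fun t => S t z) (Ici 0)
  generator : ∀ z w,
    Gen z w ↔ Tendsto (fun t : ℝ => t⁻¹ • (S t z - z)) (𝓝[>] 0) (𝓝 w)

/-- `‖χ_A f‖_{L¹(Ω)}`. -/
def l1NormOn {d : ℕ} (Ω A : Set (EuclideanSpace ℝ (Fin d)))
    (f : EuclideanSpace ℝ (Fin d) → ℝ) : ℝ :=
  ∫ x in Ω, |A.indicator f x|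

/-- The `L¹` spectral inequality on `A` with constant `D`: for all `Λ > λ₁` and all real
`(cᵢ)_{i < k}` one has `∑ cᵢ² ≤ D exp (D √Λ) ‖χ_A ∑ cᵢ eᵢ‖²_{L¹(Ω)}`, where `k` is the number
`k_Λ` of eigenvalues `≤ Λ`. (The values `k < k_Λ`, which are allowed too, only add the instances
of `k = k_Λ` in which the last coefficients vanish.) -/
def SpectralInequality {d : ℕ} (Ω A : Set (EuclideanSpace ℝ (Fin d))) (lam : ℕ → ℝ)
    (e : HilbertBasis ℕ ℝ (L2 Ω ℝ)) (D : ℝ) : Prop :=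
  ∀ Λ : ℝ, lam 0 < Λ → ∀ k : ℕ, (∀ i < k, lam i ≤ Λ) → ∀ c : ℕ → ℝ,
    ∑ i ∈ Finset.range k, c i ^ 2 ≤
      D * Real.exp (D * √Λ) *
        l1NormOn Ω A (fun x => ∑ i ∈ Finset.range k, c i * (e i : L2 Ω ℝ) x) ^ 2

end

/-! In each eigenmode the semigroup is the damping `exp (-a λᵢ t)` times a plane rotation of angular
speed `b λᵢ`. The observed first component of a mode may therefore vanish at some times, and no
single time controls the energy. Since `b ≠ 0` and `λᵢ ≥ l₀ > 0` by Poincaré, the oscillation has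
frequency at least `|b| l₀`, so its absolute value has a mean over a time set of measure `m` bounded
below uniformly in the mode (`le_setIntegral_abs_cos`).

To sum over the modes below a cutoff `Λ` without losing their number, weight the observed
coefficients `cᵢ(t)` by the final amplitudes `ρᵢ`. Then `∑ ρᵢ²` is at most a constant times `∫ ∑ ρᵢ
|cᵢ(t)| dt`, and Cauchy–Schwarz in `i` at fixed `t` leaves exactly the `ℓ²` norm that the spectral
inequality bounds, at cost `exp (D √Λ / 2)`. The other modes contribute at most `exp (-a Λ S₁) ‖z‖`
(`norm_semigroup_le_of_frequency`). Dissipation is linear in `Λ` and the cost only in `√Λ`, so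
optimising `Λ` yields the Hölder interpolation (`le_rpow_mul_rpow_of_forall_frequency`). -/

/-! ### Poincaré inequality and a lower bound for the spectrum -/

/-- Poincaré inequality for a test function supported in the ball of radius `R`. -/
lemma integral_sq_le_of_tsupport_subset_closedBall {d : ℕ} (hd : 0 < d) {R : ℝ}
    {φ : EuclideanSpace ℝ (Fin d) → ℝ} (hφ : ContDiff ℝ ∞ φ) (hc : HasCompactSupport φ)
    (hs : tsupport φ ⊆ Metric.closedBall 0 R) :
    ∫ x, φ x ^ 2 ≤ 4 * R ^ 2 * ∫ x, ‖gradient φ x‖ ^ 2 := by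
  obtain ⟨π, v, hπv, hv, hπ⟩ : ∃ (π : EuclideanSpace ℝ (Fin d) →L[ℝ] ℝ)
      (v : EuclideanSpace ℝ (Fin d)), π v = 1 ∧ ‖v‖ = 1 ∧ ∀ x, |π x| ≤ ‖x‖ :=
    ⟨EuclideanSpace.proj ⟨0, hd⟩, EuclideanSpace.single ⟨0, hd⟩ 1, by simp, by simp,
      fun x => by simpa using PiLp.norm_apply_le x ⟨0, hd⟩⟩
  have hdiff : Differentiable ℝ φ := hφ.differentiable (by simp)
  have hcont := hφ.continuous
  have hfd : Continuous (fderiv ℝ φ) := hφ.continuous_fderiv (by simp)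
  have hDc : Continuous fun x => fderiv ℝ φ x v := hfd.clm_apply continuous_const
  have hgrad : Continuous (gradient φ) :=
    (InnerProductSpace.toDual ℝ (EuclideanSpace ℝ (Fin d))).symm.continuous.comp hfd
  have hnorm : ∀ x, |fderiv ℝ φ x v| ≤ ‖gradient φ x‖ := fun x => by
    rw [← inner_gradient_left]
    refine (abs_real_inner_le_norm _ _).trans ?_
    simp [hv]
  have hder : ∀ x, fderiv ℝ (fun x => π x * φ x) x v = π x * fderiv ℝ φ x v + φ x := fun x => by
    have h := (π.hasFDerivAt (x := x)).mul (hdiff x).hasFDerivAt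
    rw [show (fun x => π x * φ x) = ⇑π * φ from rfl, h.fderiv]
    simp [hπv]
  have hDv : HasCompactSupport fun x => fderiv ℝ φ x v := hc.fderiv_apply ℝ v
  have c1 : HasCompactSupport fun x => φ x ^ 2 := by
    simp only [sq]; exact hc.mul_left
  have c2 : HasCompactSupport fun x => π x * (φ x * fderiv ℝ φ x v) := hDv.mul_left.mul_left
  have c3 : HasCompactSupport fun x => ‖gradient φ x‖ ^ 2 := by
    have h : HasCompactSupport fun x => ‖fderiv ℝ φ x‖ := (hc.fderiv ℝ).norm
    simp only [sq, gradient, LinearIsometryEquiv.norm_map]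
    exact h.mul_left
  have c4 : HasCompactSupport fun x => π x * φ x * φ x := hc.mul_left
  have i1 : Integrable fun x => φ x ^ 2 := (hcont.pow 2).integrable_of_hasCompactSupport c1
  have i2 : Integrable fun x => π x * (φ x * fderiv ℝ φ x v) :=
    (π.continuous.mul (hcont.mul hDc)).integrable_of_hasCompactSupport c2
  have i3 : Integrable fun x => ‖gradient φ x‖ ^ 2 :=
    (hgrad.norm.pow 2).integrable_of_hasCompactSupport c3
  have i4 : Integrable fun x => π x * φ x * φ x :=
    ((π.continuous.mul hcont).mul hcont).integrable_of_hasCompactSupport c4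
  -- Since `∂ᵥπ = 1`, integrating `π φ ∂ᵥφ` by parts gives `∫ φ² = -2 ∫ π φ ∂ᵥφ`.
  have parts := integral_mul_fderiv_eq_neg_fderiv_mul_of_integrable
    (μ := (volume : Measure (EuclideanSpace ℝ (Fin d))))
    (f := fun x => π x * φ x) (g := φ) (v := v)
    ((i2.add i1).congr (.of_forall fun x => by simp only [hder, Pi.add_apply]; ring))
    (i2.congr (.of_forall fun x => by ring))
    i4
    (fun x _ => (π.differentiable x).mul (hdiff x)) (fun x _ => hdiff x)
  have e1 : ∫ x, π x * φ x * fderiv ℝ φ x v = ∫ x, π x * (φ x * fderiv ℝ φ x v) :=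
    integral_congr_ae (.of_forall fun x => by ring)
  have e2 : ∫ x, fderiv ℝ (fun x => π x * φ x) x v * φ x =
      (∫ x, π x * (φ x * fderiv ℝ φ x v)) + ∫ x, φ x ^ 2 := by
    rw [← integral_add i2 i1]
    exact integral_congr_ae (.of_forall fun x => by simp only [hder]; ring)
  rw [e1, e2] at parts
  -- Young's inequality `-2 φ w ≤ φ² / 2 + 2 w²` with `w = π ∂ᵥφ`; the term `φ² / 2` is absorbed on
  -- the left.
  have key : ∫ x, -2 * (π x * (φ x * fderiv ℝ φ x v)) ≤
      ∫ x, (φ x ^ 2 / 2 + 2 * R ^ 2 * ‖gradient φ x‖ ^ 2) := by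
    refine integral_mono (i2.const_mul _) ((i1.div_const 2).add (i3.const_mul _)) fun x => ?_
    simp only
    by_cases hx : x ∈ tsupport φ
    · have hxR : ‖x‖ ≤ R := by simpa using hs hx
      have h1 : |π x| ≤ R := (hπ x).trans hxR
      have h2 : |π x * fderiv ℝ φ x v| ≤ R * ‖gradient φ x‖ := by
        rw [abs_mul]
        exact mul_le_mul h1 (hnorm x) (abs_nonneg _) ((norm_nonneg _).trans hxR)
      have h3 := sq_le_sq' (abs_le.1 h2).1 (abs_le.1 h2).2
      nlinarith [sq_nonneg (φ x + 2 * (π x * fderiv ℝ φ x v))]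
    · rw [image_eq_zero_of_notMem_tsupport hx]
      simp
      positivity
  rw [integral_const_mul, integral_add (i1.div_const 2) (i3.const_mul _), integral_div,
    integral_const_mul] at key
  linarith

lemma L2_norm_sq_eq_integral {α V : Type*} [MeasurableSpace α] {μ : Measure α}
    [NormedAddCommGroup V] [InnerProductSpace ℝ V] (f : Lp V 2 μ) :
    ‖f‖ ^ 2 = ∫ x, ‖f x‖ ^ 2 ∂μ := by
  rw [← real_inner_self_eq_norm_sq, L2.inner_def]
  simp only [real_inner_self_eq_norm_sq]

/-- Poincaré inequality in `H₀¹`. -/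
lemma HasH10Gradient.norm_sq_le {d : ℕ} (hd : 0 < d) {Ω : Set (EuclideanSpace ℝ (Fin d))}
    {R : ℝ} (hR : Ω ⊆ Metric.closedBall 0 R) {u : L2 Ω ℝ}
    {G : L2 Ω (EuclideanSpace ℝ (Fin d))} (h : HasH10Gradient Ω u G) :
    ‖u‖ ^ 2 ≤ 4 * R ^ 2 * ‖G‖ ^ 2 := by
  have hclosed : IsClosed {p : L2 Ω ℝ × L2 Ω (EuclideanSpace ℝ (Fin d)) |
      ‖p.1‖ ^ 2 ≤ 4 * R ^ 2 * ‖p.2‖ ^ 2} := isClosed_le (by fun_prop) (by fun_prop)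
  suffices hsub : testGraph Ω ⊆ {p | ‖p.1‖ ^ 2 ≤ 4 * R ^ 2 * ‖p.2‖ ^ 2} by
    have h' : (u, G) ∈ closure (testGraph Ω) := h
    have h'' := closure_minimal hsub hclosed h'
    exact h''
  rintro ⟨p, q⟩ ⟨φ, hφ, hc, hs, hp, hq⟩
  simp only [mem_ofPred_eq] at hp hq ⊢
  rw [L2_norm_sq_eq_integral, L2_norm_sq_eq_integral]
  have e1 : ∫ x in Ω, ‖p x‖ ^ 2 = ∫ x, φ x ^ 2 := by
    refine (integral_congr_ae (hp.mono fun x hx => ?_)).trans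
      (setIntegral_eq_integral_of_forall_compl_eq_zero fun x hx => ?_)
    · simp [hx]
    · simp [image_eq_zero_of_notMem_tsupport fun h => hx (hs h)]
  have e2 : ∫ x in Ω, ‖q x‖ ^ 2 = ∫ x, ‖gradient φ x‖ ^ 2 := by
    refine (integral_congr_ae (hq.mono fun x hx => ?_)).trans
      (setIntegral_eq_integral_of_forall_compl_eq_zero fun x hx => ?_)
    · simp [hx]
    · have : fderiv ℝ φ x = 0 := by
        by_contra h
        exact hx (hs (tsupport_fderiv_subset ℝ (subset_tsupport _ h)))
      simp [gradient, this]
  rw [e1, e2]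
  exact integral_sq_le_of_tsupport_subset_closedBall hd hφ hc (hs.trans hR)

/-- Testing the weak equation with the eigenfunction itself gives `‖∇eᵢ‖² = λᵢ`, and Poincaré
applies. The bound depends on `Ω` alone, which keeps the final constant independent of the
eigenbasis. -/
lemma IsDirichletEigenbasis.inv_le_lam {d : ℕ} (hd : 0 < d)
    {Ω : Set (EuclideanSpace ℝ (Fin d))} {R : ℝ} (hR0 : 0 < R)
    (hR : Ω ⊆ Metric.closedBall 0 R) {lam : ℕ → ℝ} {e : HilbertBasis ℕ ℝ (L2 Ω ℝ)}
    (h : IsDirichletEigenbasis Ω lam e) (i : ℕ) : 1 / (4 * R ^ 2) ≤ lam i := by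
  obtain ⟨G, hG, hw⟩ := h.eigen i
  have h1 := hw _ _ hG
  have h2 := hG.norm_sq_le hd hR
  rw [inner_neg_left, inner_smul_left, real_inner_self_eq_norm_sq,
    real_inner_self_eq_norm_sq, e.orthonormal.norm_eq_one] at h1
  simp only [neg_neg, conj_trivial, one_pow, mul_one] at h1
  rw [e.orthonormal.norm_eq_one, h1] at h2
  rw [div_le_iff₀ (by positivity)]
  linarith

/-! ### Sinusoids on sets of positive measure -/

/-- The set of times in an interval at which a sinusoid is small is itself small. -/
lemma volume_abs_cos_lt_le {ν φ α β ε : ℝ} (hν : 0 < ν) (hαβ : α ≤ β) (hε : 0 ≤ ε) :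
    volume {t ∈ Icc α β | |Real.cos (ν * t - φ)| < ε} ≤
      ENNReal.ofReal ((β - α + 2 * Real.pi / ν) * ε) := by
  have hπ := Real.pi_pos
  -- The `c n` are the zeros of the cosine. By Jordan's inequality each small value occurs within `π
  -- ε / (2 ν)` of one of them; `A` and `B` bound the index of the zero nearest to a time in `[α,
  -- β]`.
  set c : ℤ → ℝ := fun n => (n * Real.pi - Real.pi / 2 + φ) / ν with hcdef
  set A : ℝ := (ν * α - φ + Real.pi / 2) / Real.pi - 1 / 2 with hA
  set B : ℝ := (ν * β - φ + Real.pi / 2) / Real.pi + 1 / 2 with hB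
  have hsub : {t ∈ Icc α β | |Real.cos (ν * t - φ)| < ε} ⊆
      ⋃ n ∈ Finset.Icc ⌈A⌉ ⌊B⌋,
        Icc (c n - Real.pi * ε / (2 * ν)) (c n + Real.pi * ε / (2 * ν)) := by
    rintro t ⟨⟨h1, h2⟩, ht⟩
    set s := ν * t - φ + Real.pi / 2 with hs
    have hcos : |Real.cos (ν * t - φ)| = |Real.sin (s - round (s / Real.pi) * Real.pi)| := by
      rw [Real.sin_sub_int_mul_pi, hs, Real.sin_add_pi_div_two, abs_mul, abs_zpow]
      simp
    set n := round (s / Real.pi) with hn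
    have hr := abs_le.1 (abs_sub_round (s / Real.pi))
    rw [← hn] at hr
    have hs' : s / Real.pi * Real.pi = s := by field_simp
    have hle : |s - n * Real.pi| ≤ Real.pi / 2 := by
      rw [abs_le]; constructor <;> nlinarith
    have hsin := Real.mul_abs_le_abs_sin hle
    rw [← hcos] at hsin
    have hlt : |s - n * Real.pi| ≤ Real.pi * ε / 2 := by
      have := hsin.trans ht.le
      rw [div_mul_eq_mul_div, div_le_iff₀ hπ] at this
      linarith
    rw [abs_le] at hlt
    have hlo : (ν * α - φ + Real.pi / 2) / Real.pi ≤ s / Real.pi := by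
      rw [hs]; gcongr
    have hhi : s / Real.pi ≤ (ν * β - φ + Real.pi / 2) / Real.pi := by
      rw [hs]; gcongr
    simp only [mem_iUnion, Finset.mem_Icc, exists_prop]
    refine ⟨n, ⟨Int.ceil_le.2 (by linarith), Int.le_floor.2 (by linarith)⟩, ?_, ?_⟩
    · have : t - (c n - Real.pi * ε / (2 * ν)) = (s - n * Real.pi + Real.pi * ε / 2) / ν := by
        simp only [hcdef, hs]; field_simp; ring
      have h0 : 0 ≤ (s - n * Real.pi + Real.pi * ε / 2) / ν :=
        div_nonneg (by linarith) hν.le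
      linarith
    · have : (c n + Real.pi * ε / (2 * ν)) - t = (Real.pi * ε / 2 - (s - n * Real.pi)) / ν := by
        simp only [hcdef, hs]; field_simp; ring
      have h0 : 0 ≤ (Real.pi * ε / 2 - (s - n * Real.pi)) / ν :=
        div_nonneg (by linarith) hν.le
      linarith
  have hBA : B - A = ν * (β - α) / Real.pi + 1 := by
    simp only [hA, hB]; field_simp; ring
  have hcard : ((Finset.Icc ⌈A⌉ ⌊B⌋).card : ℝ) ≤ ν * (β - α) / Real.pi + 2 := by
    have hnn : 0 ≤ ν * (β - α) / Real.pi :=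
      div_nonneg (mul_nonneg hν.le (by linarith)) hπ.le
    rw [Int.card_Icc]
    have : ((⌊B⌋ + 1 - ⌈A⌉).toNat : ℝ) = ((max (⌊B⌋ + 1 - ⌈A⌉) 0 : ℤ) : ℝ) := by
      rw [← Int.toNat_eq_max]; norm_cast
    rw [this, Int.cast_max]
    push_cast
    refine max_le ?_ (by linarith)
    have := Int.floor_le B
    have := Int.le_ceil A
    linarith
  refine (measure_mono hsub).trans ((measure_biUnion_finset_le _ _).trans ?_)
  simp only [Real.volume_Icc]
  have hlen : ∀ n, c n + Real.pi * ε / (2 * ν) - (c n - Real.pi * ε / (2 * ν)) =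
      Real.pi * ε / ν := fun n => by field_simp; ring
  simp only [hlen, Finset.sum_const, nsmul_eq_mul]
  rw [← ENNReal.ofReal_natCast, ← ENNReal.ofReal_mul (by positivity)]
  refine ENNReal.ofReal_le_ofReal ?_
  calc _ ≤ (ν * (β - α) / Real.pi + 2) * (Real.pi * ε / ν) := by gcongr
    _ = _ := by field_simp

/-- The threshold `ε = m / (2 L)` is tuned so that the times with `|cos| < ε` fill at most half of
`F`; on the other half the integrand is at least `ε`. Using `ν₀` in `L` makes the bound uniform in
the frequency. -/
lemma le_setIntegral_abs_cos {ν ν₀ φ α β : ℝ} (hν₀ : 0 < ν₀) (hν : ν₀ ≤ ν) (hαβ : α < β)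
    {F : Set ℝ} (hF : NullMeasurableSet F) (hFs : F ⊆ Icc α β) :
    volume.real F ^ 2 / (4 * (β - α + 2 * Real.pi / ν₀)) ≤
      ∫ t in F, |Real.cos (ν * t - φ)| := by
  have hπ := Real.pi_pos
  have hνp := hν₀.trans_le hν
  set m := volume.real F
  have hm : 0 ≤ m := measureReal_nonneg
  set L := β - α + 2 * Real.pi / ν₀
  have hL : 0 < L := by have : 0 < 2 * Real.pi / ν₀ := by positivity
                        simp only [L]; linarith
  set ε := m / (2 * L) with hε
  have hε0 : 0 ≤ ε := by positivity
  set C : Set ℝ := {t | |Real.cos (ν * t - φ)| < ε}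
  have hcont : Continuous fun t => |Real.cos (ν * t - φ)| := by fun_prop
  have hC : MeasurableSet C := (isOpen_lt hcont continuous_const).measurableSet
  have hFfin : volume F ≠ ⊤ := (measure_mono hFs).trans_lt (by simp) |>.ne
  have hsmall : volume.real (F ∩ C) ≤ m / 2 := by
    have h1 : volume (F ∩ C) ≤ ENNReal.ofReal (m / 2) := by
      refine (measure_mono (inter_subset_inter_left C hFs)).trans
        ((volume_abs_cos_lt_le hνp hαβ.le hε0).trans (ENNReal.ofReal_le_ofReal ?_))
      have : (β - α + 2 * Real.pi / ν) * ε ≤ L * ε := by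
        simp only [L]; gcongr
      refine this.trans (le_of_eq ?_)
      rw [hε]; field_simp
    exact ENNReal.toReal_le_of_le_ofReal (by positivity) h1
  have hdiff : m / 2 ≤ volume.real (F \ C) := by
    have := measureReal_inter_add_sdiff (μ := volume) (s := F) hC hFfin
    linarith
  have hint : IntegrableOn (fun t => |Real.cos (ν * t - φ)|) F :=
    (hcont.continuousOn.integrableOn_compact isCompact_Icc).mono_set hFs
  calc m ^ 2 / (4 * L) = ε * (m / 2) := by rw [hε]; field_simp; ring
    _ ≤ ε * volume.real (F \ C) := by gcongr
    _ = ∫ t in F \ C, ε := by rw [setIntegral_const, smul_eq_mul, mul_comm]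
    _ ≤ ∫ t in F \ C, |Real.cos (ν * t - φ)| := by
      refine setIntegral_mono_on₀ ?_ (hint.mono_set sdiff_subset)
        (hF.diff hC.nullMeasurableSet) fun t ht => not_lt.1 ht.2
      exact integrableOn_const ((measure_mono sdiff_subset).trans_lt hFfin.lt_top).ne
    _ ≤ _ := setIntegral_mono_set hint (.of_forall fun t => abs_nonneg _)
      (.of_forall sdiff_subset)

/-- A sinusoid `x cos + y sin` has an amplitude and a phase. -/
lemma exists_phase (x y : ℝ) : ∃ φ, ∀ s,
    x * Real.cos s + y * Real.sin s = √(x ^ 2 + y ^ 2) * Real.cos (s - φ) := by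
  let w : ℂ := ⟨x, y⟩
  have hw : √(x ^ 2 + y ^ 2) = ‖w‖ := by
    rw [Complex.norm_def, Complex.normSq_mk]; ring_nf
  refine ⟨w.arg, fun s => ?_⟩
  have h1 := Complex.norm_mul_cos_arg w
  have h2 := Complex.norm_mul_sin_arg w
  simp only [w] at h1 h2
  rw [hw, Real.cos_sub]
  linear_combination (-Real.cos s) * h1 - Real.sin s * h2

/-! ### Coordinates of `L²(Ω; ℝ²)` and the operator on eigenmodes -/

section components

variable {d : ℕ} {Ω : Set (EuclideanSpace ℝ (Fin d))}

/-- The map `z ↦ zᵢ` as a continuous linear map `L²(Ω; ℝ²) → L²(Ω)`. -/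
noncomputable def componentL (Ω : Set (EuclideanSpace ℝ (Fin d))) (i : Fin 2) :
    L2 Ω (EuclideanSpace ℝ (Fin 2)) →L[ℝ] L2 Ω ℝ :=
  (EuclideanSpace.proj i : EuclideanSpace ℝ (Fin 2) →L[ℝ] ℝ).compLpL 2 (volume.restrict Ω)

/-- The inclusion `L²(Ω) → L²(Ω; ℝ²)` onto the `i`-th coordinate. -/
noncomputable def inclusionL (Ω : Set (EuclideanSpace ℝ (Fin d))) (i : Fin 2) :
    L2 Ω ℝ →L[ℝ] L2 Ω (EuclideanSpace ℝ (Fin 2)) :=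
  (ContinuousLinearMap.toSpanSingleton ℝ (EuclideanSpace.single i (1 : ℝ))).compLpL 2
    (volume.restrict Ω)

lemma componentL_apply (i : Fin 2) (z : L2 Ω (EuclideanSpace ℝ (Fin 2))) :
    componentL Ω i z = component i z := rfl

lemma coeFn_component (i : Fin 2) (z : L2 Ω (EuclideanSpace ℝ (Fin 2))) :
    component i z =ᵐ[volume.restrict Ω] fun x => z x i := by
  filter_upwards [(EuclideanSpace.proj i : EuclideanSpace ℝ (Fin 2) →L[ℝ] ℝ).coeFn_compLp z]
    with x hx using hx

lemma coeFn_inclusionL (i : Fin 2) (f : L2 Ω ℝ) :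
    inclusionL Ω i f =ᵐ[volume.restrict Ω] fun x => f x • EuclideanSpace.single i (1 : ℝ) := by
  filter_upwards [(ContinuousLinearMap.toSpanSingleton ℝ
    (EuclideanSpace.single i (1 : ℝ))).coeFn_compLp f] with x hx using hx

lemma component_inclusionL_self (i : Fin 2) (f : L2 Ω ℝ) : component i (inclusionL Ω i f) = f := by
  refine Lp.ext ?_
  filter_upwards [coeFn_component i (inclusionL Ω i f), coeFn_inclusionL i f] with x h1 h2
  simp [h1, h2]

lemma component_inclusionL_of_ne {i j : Fin 2} (h : j ≠ i) (f : L2 Ω ℝ) :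
    component j (inclusionL Ω i f) = 0 := by
  refine Lp.ext ?_
  filter_upwards [coeFn_component j (inclusionL Ω i f), coeFn_inclusionL i f,
    Lp.coeFn_zero ℝ 2 (volume.restrict Ω)] with x h1 h2 h3
  rw [h1, h2, h3]; simp [h]

lemma inclusionL_component_add (z : L2 Ω (EuclideanSpace ℝ (Fin 2))) :
    inclusionL Ω 0 (component 0 z) + inclusionL Ω 1 (component 1 z) = z := by
  refine Lp.ext ?_
  filter_upwards [Lp.coeFn_add (inclusionL Ω 0 (component 0 z)) (inclusionL Ω 1 (component 1 z)),
    coeFn_inclusionL 0 (component 0 z), coeFn_inclusionL 1 (component 1 z),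
    coeFn_component 0 z, coeFn_component 1 z] with x h1 h2 h3 h4 h5
  rw [h1, Pi.add_apply, h2, h3, h4, h5]
  ext i
  fin_cases i <;> simp

lemma norm_sq_eq_component (z : L2 Ω (EuclideanSpace ℝ (Fin 2))) :
    ‖z‖ ^ 2 = ‖component 0 z‖ ^ 2 + ‖component 1 z‖ ^ 2 := by
  have hi : ∀ f : L2 Ω ℝ, Integrable (fun x => ‖f x‖ ^ 2) (volume.restrict Ω) := fun f =>
    (Lp.memLp f).integrable_norm_pow (by norm_num)
  rw [L2_norm_sq_eq_integral, L2_norm_sq_eq_integral, L2_norm_sq_eq_integral,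
    ← integral_add (hi _) (hi _)]
  refine integral_congr_ae ?_
  filter_upwards [coeFn_component 0 z, coeFn_component 1 z] with x h0 h1
  rw [EuclideanSpace.norm_sq_eq, Fin.sum_univ_two, h0, h1]

lemma IsDirichletLaplacian.zero : IsDirichletLaplacian Ω 0 0 := by
  refine ⟨0, subset_closure ⟨0, contDiff_const, HasCompactSupport.zero, by simp, ?_, ?_⟩, by simp⟩
  · exact Lp.coeFn_zero _ _ _
  · filter_upwards [Lp.coeFn_zero (EuclideanSpace ℝ (Fin d)) 2 (volume.restrict Ω)] with x hx
    have : fderiv ℝ (0 : EuclideanSpace ℝ (Fin d) → ℝ) x = 0 := by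
      simp
    rw [hx, gradient, this]
    simp

variable {a b : ℝ} {lam : ℕ → ℝ} {e : HilbertBasis ℕ ℝ (L2 Ω ℝ)}

lemma IsDirichletEigenbasis.coupledOperator_zero (h : IsDirichletEigenbasis Ω lam e) (i : ℕ) :
    CoupledOperator Ω a b (inclusionL Ω 0 (e i))
      (-(a * lam i) • inclusionL Ω 0 (e i) - (b * lam i) • inclusionL Ω 1 (e i)) := by
  refine ⟨-(lam i • e i), 0, ?_, ?_, ?_, ?_⟩
  · rw [component_inclusionL_self]; exact h.eigen i
  · rw [component_inclusionL_of_ne (by decide)]; exact .zero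
  · rw [← componentL_apply, map_sub, map_smul, map_smul]
    simp only [componentL_apply]
    rw [component_inclusionL_self, component_inclusionL_of_ne (by decide)]
    module
  · rw [← componentL_apply, map_sub, map_smul, map_smul]
    simp only [componentL_apply]
    rw [component_inclusionL_self, component_inclusionL_of_ne (by decide)]
    module

lemma IsDirichletEigenbasis.coupledOperator_one (h : IsDirichletEigenbasis Ω lam e) (i : ℕ) :
    CoupledOperator Ω a b (inclusionL Ω 1 (e i))
      ((b * lam i) • inclusionL Ω 0 (e i) - (a * lam i) • inclusionL Ω 1 (e i)) := by
  refine ⟨0, -(lam i • e i), ?_, ?_, ?_, ?_⟩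
  · rw [component_inclusionL_of_ne (by decide)]; exact .zero
  · rw [component_inclusionL_self]; exact h.eigen i
  · rw [← componentL_apply, map_sub, map_smul, map_smul]
    simp only [componentL_apply]
    rw [component_inclusionL_self, component_inclusionL_of_ne (by decide)]
    module
  · rw [← componentL_apply, map_sub, map_smul, map_smul]
    simp only [componentL_apply]
    rw [component_inclusionL_self, component_inclusionL_of_ne (by decide)]
    module

end components

/-! ### The semigroup on invariant planes -/

section semigroup

variable {H : Type*} [NormedAddCommGroup H] [NormedSpace ℝ H]

/-- Orbits of points of the domain of the generator are right differentiable. -/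
lemma IsSemigroupGeneratedBy.hasDerivWithinAt {S : ℝ → H →L[ℝ] H} {Gen : H → H → Prop}
    (hS : IsSemigroupGeneratedBy S Gen) {z w : H} (h : Gen z w) {t : ℝ} (ht : 0 ≤ t) :
    HasDerivWithinAt (fun s => S s z) (S t w) (Ici t) t := by
  rw [← hasDerivWithinAt_Ioi_iff_Ici, hasDerivWithinAt_iff_tendsto_slope' self_notMem_Ioi]
  have hshift : Tendsto (fun s => s - t) (𝓝[>] t) (𝓝[>] 0) := by
    refine tendsto_nhdsWithin_iff.2 ⟨?_, ?_⟩
    · exact ((continuous_id.sub continuous_const).tendsto' t 0 (by simp)).mono_left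
        nhdsWithin_le_nhds
    · filter_upwards [self_mem_nhdsWithin] with s hs
      simpa using hs
  refine (((S t).continuous.tendsto w).comp (((hS.generator z w).1 h).comp hshift)).congr' ?_
  filter_upwards [self_mem_nhdsWithin] with s hs
  have hst : S s = (S t).comp (S (s - t)) := by
    rw [← hS.comp t (s - t) ht (sub_nonneg.2 (mem_Ioi.1 hs).le), add_sub_cancel]
  simp [slope, hst]

/-- On a two-dimensional subspace spanned by `v`, `w` on which the generator acts as the matrix
`(-α, β; -β, -α)`, the semigroup acts as the exponential of that matrix. -/
lemma IsSemigroupGeneratedBy.apply_eq_rotation {S : ℝ → H →L[ℝ] H} {Gen : H → H → Prop}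
    (hS : IsSemigroupGeneratedBy S Gen) {v w : H} {α β : ℝ}
    (hv : Gen v (-α • v - β • w)) (hw : Gen w (β • v - α • w)) {t : ℝ} (ht : 0 ≤ t) :
    S t v = Real.exp (-α * t) • (Real.cos (β * t) • v - Real.sin (β * t) • w) ∧
    S t w = Real.exp (-α * t) • (Real.sin (β * t) • v + Real.cos (β * t) • w) := by
  -- By linearity of `S t`, the pair of orbits solves an equation driven by this bounded operator,
  -- although the generator may be unbounded. ODE uniqueness then needs only right derivatives.
  let Λ : H × H →L[ℝ] H × H :=
    ((-α) • ContinuousLinearMap.fst ℝ H H - β • ContinuousLinearMap.snd ℝ H H).prod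
      (β • ContinuousLinearMap.fst ℝ H H - α • ContinuousLinearMap.snd ℝ H H)
  let f : ℝ → H × H := fun s => (S s v, S s w)
  let g : ℝ → H × H := fun s =>
    (Real.exp (-α * s) • (Real.cos (β * s) • v - Real.sin (β * s) • w),
     Real.exp (-α * s) • (Real.sin (β * s) • v + Real.cos (β * s) • w))
  have hg : ∀ s, HasDerivAt g (Λ (g s)) s := fun s => by
    have he : HasDerivAt (fun s => Real.exp (-α * s)) (Real.exp (-α * s) * -α) s := by
      simpa using ((hasDerivAt_id s).const_mul (-α)).exp
    have hc : HasDerivAt (fun s => Real.cos (β * s)) (-Real.sin (β * s) * β) s := by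
      simpa using ((hasDerivAt_id s).const_mul β).cos
    have hs : HasDerivAt (fun s => Real.sin (β * s)) (Real.cos (β * s) * β) s := by
      simpa using ((hasDerivAt_id s).const_mul β).sin
    refine ((he.smul ((hc.smul_const v).sub (hs.smul_const w))).prodMk
      (he.smul ((hs.smul_const v).add (hc.smul_const w)))).congr_deriv ?_
    simp only [Λ, g, ContinuousLinearMap.prod_apply, sub_apply,
      smul_apply, ContinuousLinearMap.coe_fst', ContinuousLinearMap.coe_snd',
      Prod.mk.injEq, Pi.sub_apply, Pi.add_apply]
    constructor <;> module
  have key : EqOn f g (Icc 0 t) := by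
    refine ODE_solution_unique (v := fun _ => Λ) (fun _ => Λ.lipschitz)
      (((hS.continuousOn v).prodMk (hS.continuousOn w)).mono Icc_subset_Ici_self) (fun s hs => ?_)
      (fun s _ => (hg s).continuousAt.continuousWithinAt) (fun s _ => (hg s).hasDerivWithinAt) ?_
    · refine ((hS.hasDerivWithinAt hv hs.1).prodMk (hS.hasDerivWithinAt hw hs.1)).congr_deriv ?_
      simp [Λ, f]
    · simp [f, g, hS.at_zero]
  exact Prod.mk.inj (key ⟨ht, le_rfl⟩)

end semigroup

/-! ### Evolution of the Fourier coefficients -/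

section diagonalisation

variable {d : ℕ} {Ω : Set (EuclideanSpace ℝ (Fin d))} {a b : ℝ} {lam : ℕ → ℝ}
  {e : HilbertBasis ℕ ℝ (L2 Ω ℝ)}
  {S : ℝ → L2 Ω (EuclideanSpace ℝ (Fin 2)) →L[ℝ] L2 Ω (EuclideanSpace ℝ (Fin 2))}

/-- Two continuous functionals that agree on the basis agree everywhere, by density of its span. -/
lemma HilbertBasis.inner_eq_of_diagonal {H : Type*} [NormedAddCommGroup H]
    [InnerProductSpace ℝ H] (e : HilbertBasis ℕ ℝ H) (A : H →L[ℝ] H) (μ : ℕ → ℝ)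
    (hA : ∀ i, A (e i) = μ i • e i) (f : H) (i : ℕ) : inner ℝ (e i) (A f) = μ i * inner ℝ (e i) f := by
  have h : (innerSL ℝ (e i)).comp A = μ i • innerSL ℝ (e i) := by
    refine ContinuousLinearMap.ext_on (s := range e)
      (Submodule.dense_iff_topologicalClosure_eq_top.2 e.dense_span) ?_
    rintro _ ⟨j, rfl⟩
    by_cases hij : i = j
    · subst hij; simp [hA]
    · simp [hA, e.orthonormal.2 hij]
  exact DFunLike.congr_fun h f

/-- Each of the four scalar blocks of `S t` is diagonal in `e`, with entries read off from the
rotation on the plane of the mode. -/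
lemma IsDirichletEigenbasis.inner_component_semigroup (h : IsDirichletEigenbasis Ω lam e)
    (hS : IsSemigroupGeneratedBy S (CoupledOperator Ω a b)) {t : ℝ} (ht : 0 ≤ t)
    (z : L2 Ω (EuclideanSpace ℝ (Fin 2))) (i : ℕ) :
    inner ℝ (e i) (component 0 (S t z)) = Real.exp (-(a * lam i) * t) *
      (Real.cos (b * lam i * t) * inner ℝ (e i) (component 0 z) +
        Real.sin (b * lam i * t) * inner ℝ (e i) (component 1 z)) ∧
    inner ℝ (e i) (component 1 (S t z)) = Real.exp (-(a * lam i) * t) *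
      (Real.cos (b * lam i * t) * inner ℝ (e i) (component 1 z) -
        Real.sin (b * lam i * t) * inner ℝ (e i) (component 0 z)) := by
  have hact := fun j => hS.apply_eq_rotation (h.coupledOperator_zero j) (h.coupledOperator_one j) ht
  have hc : ∀ (p q : ℝ) j, component 0 (p • inclusionL Ω 0 (e j) + q • inclusionL Ω 1 (e j)) =
      p • e j ∧ component 1 (p • inclusionL Ω 0 (e j) + q • inclusionL Ω 1 (e j)) = q • e j := by
    intro p q j
    simp only [← componentL_apply, map_add, map_smul]
    simp only [componentL_apply]
    simp [component_inclusionL_self, component_inclusionL_of_ne]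
  have hd := fun p q (μ : ℕ → ℝ) hA =>
    e.inner_eq_of_diagonal ((componentL Ω p).comp ((S t).comp (inclusionL Ω q))) μ hA
  have h00 := hd 0 0 (fun j => Real.exp (-(a * lam j) * t) * Real.cos (b * lam j * t)) fun j => by
    rw [← (hc _ (-(Real.exp (-(a * lam j) * t) * Real.sin (b * lam j * t))) j).1]
    simp only [ContinuousLinearMap.comp_apply, componentL_apply, (hact j).1]
    congr 1; module
  have h10 := hd 1 0 (fun j => -(Real.exp (-(a * lam j) * t) * Real.sin (b * lam j * t))) fun j => by
    rw [← (hc (Real.exp (-(a * lam j) * t) * Real.cos (b * lam j * t)) _ j).2]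
    simp only [ContinuousLinearMap.comp_apply, componentL_apply, (hact j).1]
    congr 1; module
  have h01 := hd 0 1 (fun j => Real.exp (-(a * lam j) * t) * Real.sin (b * lam j * t)) fun j => by
    rw [← (hc _ (Real.exp (-(a * lam j) * t) * Real.cos (b * lam j * t)) j).1]
    simp only [ContinuousLinearMap.comp_apply, componentL_apply, (hact j).2]
    congr 1; module
  have h11 := hd 1 1 (fun j => Real.exp (-(a * lam j) * t) * Real.cos (b * lam j * t)) fun j => by
    rw [← (hc (Real.exp (-(a * lam j) * t) * Real.sin (b * lam j * t)) _ j).2]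
    simp only [ContinuousLinearMap.comp_apply, componentL_apply, (hact j).2]
    congr 1; module
  simp only [ContinuousLinearMap.comp_apply] at h00 h10 h01 h11
  have hz := inclusionL_component_add z
  constructor
  · conv_lhs => rw [← hz, ← componentL_apply, map_add, map_add, inner_add_right, h00, h01]
    ring
  · conv_lhs => rw [← hz, ← componentL_apply, map_add, map_add, inner_add_right, h10, h11]
    ring

end diagonalisation

/-! ### Frequency cutoff and optimisation -/

section interpolation

/-- Optimising `Z ≤ P exp (β √Λ) (X + exp (-a Λ s) N)` over the frequency `Λ`. -/
lemma le_rpow_mul_rpow_of_forall_frequency {a s N X Z P β θ : ℝ} (ha : 0 < a) (hs : 0 < s)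
    (hN : 0 < N) (hX : 0 ≤ X) (hP : 1 ≤ P) (hZN : Z ≤ N) (hθ : θ ∈ Ioo (0 : ℝ) 1)
    (h : ∀ Λ, 0 ≤ Λ → Z ≤ P * Real.exp (β * √Λ) * (X + Real.exp (-(a * Λ * s)) * N)) :
    Z ≤ 2 * P * Real.exp (β ^ 2 / (4 * a * θ * s)) * X ^ (1 - θ) * N ^ θ := by
  obtain ⟨hθ0, hθ1⟩ := hθ
  set K := Real.exp (β ^ 2 / (4 * a * θ * s)) with hK
  have hK1 : 1 ≤ K := Real.one_le_exp (by positivity)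
  -- `X` may vanish, whereas the optimal frequency involves `log (N / X)`; hence the shift by `ε`,
  -- removed in the limit.
  have main : ∀ ε > 0, Z ≤ 2 * P * K * (X + ε) ^ (1 - θ) * N ^ θ := by
    intro ε hε
    set Y := X + ε with hY
    have hY0 : 0 < Y := by linarith
    have hpos : 0 < Y ^ (1 - θ) * N ^ θ := by positivity
    rcases le_total N Y with hNY | hNY
    · have h1 : N ≤ Y ^ (1 - θ) * N ^ θ := by
        calc N = N ^ (1 - θ) * N ^ θ := by rw [← Real.rpow_add hN]; simp
          _ ≤ _ := by
            gcongr
      have h2 : 1 ≤ 2 * P * K := by nlinarith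
      nlinarith
    · set l := Real.log (N / Y) with hl
      have hl0 : 0 ≤ l := Real.log_nonneg ((one_le_div hY0).2 hNY)
      have hexpl : Real.exp l = N / Y := Real.exp_log (by positivity)
      -- This frequency makes the remainder `exp (-a Λ s) N` equal to `Y`.
      set Λ := l / (a * s) with hΛ
      have hΛ0 : 0 ≤ Λ := by positivity
      have hexp : Real.exp (-(a * Λ * s)) * N = Y := by
        have : a * Λ * s = l := by rw [hΛ]; field_simp
        rw [this, Real.exp_neg, hexpl]; field_simp
      -- Completing the square: the `√Λ` cost becomes `(N / Y) ^ θ` times a constant.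
      have hyoung : β * √Λ ≤ θ * l + β ^ 2 / (4 * a * θ * s) := by
        have hsq := Real.sq_sqrt hΛ0
        have hl' : l = a * s * √Λ ^ 2 := by rw [hsq, hΛ]; field_simp
        rw [hl']
        have : θ * (a * s * √Λ ^ 2) + β ^ 2 / (4 * a * θ * s) - β * √Λ =
            (2 * a * θ * s * √Λ - β) ^ 2 / (4 * a * θ * s) := by field_simp; ring
        have h0 : 0 ≤ (2 * a * θ * s * √Λ - β) ^ 2 / (4 * a * θ * s) := by positivity
        linarith
      have hfac : Real.exp (β * √Λ) ≤ (N / Y) ^ θ * K := by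
        calc _ ≤ Real.exp (θ * l + β ^ 2 / (4 * a * θ * s)) := Real.exp_le_exp.2 hyoung
          _ = _ := by
            rw [Real.exp_add, ← hexpl, ← Real.exp_mul, mul_comm θ]
      have hpow : (N / Y) ^ θ * Y = Y ^ (1 - θ) * N ^ θ := by
        rw [Real.div_rpow hN.le hY0.le, Real.rpow_sub hY0, Real.rpow_one]
        ring
      calc Z ≤ P * Real.exp (β * √Λ) * (X + Real.exp (-(a * Λ * s)) * N) := h Λ hΛ0
        _ ≤ P * ((N / Y) ^ θ * K) * (2 * Y) := by
          rw [hexp]; gcongr; linarith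
        _ = 2 * P * K * ((N / Y) ^ θ * Y) := by ring
        _ = _ := by rw [hpow]; ring
  have hcont : Tendsto (fun ε => 2 * P * K * (X + ε) ^ (1 - θ) * N ^ θ) (𝓝[>] 0)
      (𝓝 (2 * P * K * X ^ (1 - θ) * N ^ θ)) := by
    have : Continuous fun ε => 2 * P * K * (X + ε) ^ (1 - θ) * N ^ θ :=
      (continuous_const.mul ((Real.continuous_rpow_const (by linarith)).comp
        (continuous_const.add continuous_id))).mul continuous_const
    exact (this.tendsto' 0 _ (by simp)).mono_left nhdsWithin_le_nhds
  exact ge_of_tendsto hcont (by filter_upwards [self_mem_nhdsWithin] with ε hε using main ε hε)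

/-- A frequency cutoff below `Λ` beyond which the dissipation is at least `exp (-2 a Λ s)`. -/
lemma exists_cutoff {lam r : ℕ → ℝ} {a s Λ W : ℝ} (hmono : Monotone lam) (hlam : ∀ i, 0 ≤ lam i)
    (ha : 0 ≤ a) (hs : 0 ≤ s) (hr : ∀ i, 0 ≤ r i) (hsum : HasSum r W) (hW : 0 < W) :
    ∃ k, (∀ i < k, lam i < Λ) ∧ ∀ (q : ℕ → ℝ) (Q : ℝ), HasSum q Q →
      (∀ i, q i ≤ Real.exp (-(2 * a * lam i * s)) * r i) →
      Q - ∑ i ∈ Finset.range k, q i ≤ Real.exp (-(2 * a * Λ * s)) * W := by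
  -- The cutoff depends on `r` only, so it serves every dominated sequence `q`, in particular at all
  -- times at once.
  by_cases hex : ∃ k, Λ ≤ lam k
  · classical
    refine ⟨Nat.find hex, fun i hi => not_le.1 (Nat.find_min hex hi), fun q Q hq hle => ?_⟩
    set k := Nat.find hex
    have hk : Λ ≤ lam k := Nat.find_spec hex
    have h1 := (hasSum_nat_add_iff' k).2 hq
    have h2 := ((hasSum_nat_add_iff' k).2 hsum).mul_left (Real.exp (-(2 * a * Λ * s)))
    refine (hasSum_le (fun i => ?_) h1 h2).trans ?_
    · refine (hle _).trans ?_
      have : Λ ≤ lam (i + k) := hk.trans (hmono (Nat.le_add_left _ _))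
      gcongr
      exact hr _
    · gcongr
      exact sub_le_self _ (Finset.sum_nonneg fun i _ => hr i)
  -- Divergence of `lam` is not assumed. If all frequencies lie below `Λ`, summability of `r` and
  -- positivity of `W` supply the cutoff instead.
  · push Not at hex
    have htail : Tendsto (fun k => W - ∑ i ∈ Finset.range k, r i) atTop (𝓝 (W - W)) :=
      tendsto_const_nhds.sub hsum.tendsto_sum_nat
    rw [sub_self] at htail
    have hpos : 0 < Real.exp (-(2 * a * Λ * s)) * W := by positivity
    obtain ⟨k, hk⟩ := (htail.eventually_lt_const hpos).exists
    refine ⟨k, fun i _ => hex i, fun q Q hq hle => ?_⟩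
    refine (hasSum_le (fun i => ?_) ((hasSum_nat_add_iff' k).2 hq)
      ((hasSum_nat_add_iff' k).2 hsum)).trans hk.le
    refine (hle _).trans (mul_le_of_le_one_left (hr _) (Real.exp_le_one_iff.2 ?_))
    have := hlam (i + k)
    have : 0 ≤ 2 * a * lam (i + k) * s := by positivity
    linarith

end interpolation

/-! ### Parseval identities -/

section hilbertBasis

variable {H : Type*} [NormedAddCommGroup H] [InnerProductSpace ℝ H]

lemma HilbertBasis.hasSum_inner_sq (e : HilbertBasis ℕ ℝ H) (f : H) :
    HasSum (fun i => inner ℝ (e i) f ^ 2) (‖f‖ ^ 2) := by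
  have := e.hasSum_inner_mul_inner f f
  rw [real_inner_self_eq_norm_sq] at this
  refine this.congr_fun fun i => ?_
  rw [real_inner_comm (e i) f, sq]

lemma HilbertBasis.norm_sub_sum_sq (e : HilbertBasis ℕ ℝ H) (f : H) (k : ℕ) :
    ‖f - ∑ i ∈ Finset.range k, inner ℝ (e i) f • e i‖ ^ 2 =
      ‖f‖ ^ 2 - ∑ i ∈ Finset.range k, inner ℝ (e i) f ^ 2 := by
  have h1 : inner ℝ f (∑ i ∈ Finset.range k, inner ℝ (e i) f • e i) =
      ∑ i ∈ Finset.range k, inner ℝ (e i) f ^ 2 := by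
    rw [inner_sum]
    exact Finset.sum_congr rfl fun i _ => by
      rw [inner_smul_right, real_inner_comm (e i) f, sq]
  have h2 : ‖∑ i ∈ Finset.range k, inner ℝ (e i) f • e i‖ ^ 2 =
      ∑ i ∈ Finset.range k, inner ℝ (e i) f ^ 2 := by
    rw [← real_inner_self_eq_norm_sq, e.orthonormal.inner_sum]
    simp [sq]
  rw [norm_sub_sq_real, h1, h2]
  ring

end hilbertBasis

/-! ### The `L¹` observation -/

section observation

variable {d : ℕ} {Ω : Set (EuclideanSpace ℝ (Fin d))}

lemma l1NormOn_nonneg (Ω A : Set (EuclideanSpace ℝ (Fin d))) (f : EuclideanSpace ℝ (Fin d) → ℝ) :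
    0 ≤ l1NormOn Ω A f :=
  integral_nonneg fun _ => abs_nonneg _

lemma l1NormOn_congr_ae {A : Set (EuclideanSpace ℝ (Fin d))}
    {f g : EuclideanSpace ℝ (Fin d) → ℝ} (h : f =ᵐ[volume.restrict Ω] g) :
    l1NormOn Ω A f = l1NormOn Ω A g :=
  integral_congr_ae (h.mono fun x hx => by simp only [indicator, hx])

lemma l1NormOn_zero (A : Set (EuclideanSpace ℝ (Fin d))) : l1NormOn Ω A (0 : L2 Ω ℝ) = 0 := by
  rw [l1NormOn_congr_ae (Lp.coeFn_zero ℝ 2 (volume.restrict Ω))]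
  simp [l1NormOn]

lemma coeFn_sum_smul (e : ℕ → L2 Ω ℝ) (c : ℕ → ℝ) (k : ℕ) :
    (∑ i ∈ Finset.range k, c i • e i : L2 Ω ℝ) =ᵐ[volume.restrict Ω]
      fun x => ∑ i ∈ Finset.range k, c i * e i x := by
  induction k with
  | zero =>
    simp only [Finset.range_zero, Finset.sum_empty]
    exact Lp.coeFn_zero ℝ 2 (volume.restrict Ω)
  | succ k ih =>
    rw [Finset.sum_range_succ]
    filter_upwards [ih, Lp.coeFn_add (∑ i ∈ Finset.range k, c i • e i) (c k • e k),
      Lp.coeFn_smul (c k) (e k)] with x h1 h2 h3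
    rw [h2, Pi.add_apply, h1, h3, Finset.sum_range_succ]
    rfl

variable [IsFiniteMeasure (volume.restrict Ω)]

lemma L2_integral_abs_le {α : Type*} [MeasurableSpace α] {μ : Measure α} [IsFiniteMeasure μ]
    (f : Lp ℝ 2 μ) : ∫ x, |f x| ∂μ ≤ ‖Lp.const 2 μ (1 : ℝ)‖ * ‖f‖ := by
  have h := real_inner_le_norm (|f|) (Lp.const 2 μ (1 : ℝ))
  rw [norm_abs_eq_norm, L2.inner_def] at h
  rw [mul_comm]
  refine le_trans (le_of_eq (integral_congr_ae ?_)) h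
  filter_upwards [Lp.coeFn_abs f, Lp.coeFn_const 2 μ (1 : ℝ)] with x h1 h2
  rw [h1, h2]; simp

lemma L2_integrable {α : Type*} [MeasurableSpace α] {μ : Measure α} [IsFiniteMeasure μ]
    (f : Lp ℝ 2 μ) : Integrable f μ :=
  (Lp.memLp f).integrable one_le_two

/-- Reverse triangle inequality, then Cauchy–Schwarz against the constant `1`. -/
lemma abs_l1NormOn_sub_le {A : Set (EuclideanSpace ℝ (Fin d))} (hA : NullMeasurableSet A volume)
    (f g : L2 Ω ℝ) :
    |l1NormOn Ω A f - l1NormOn Ω A g| ≤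
      ‖Lp.const 2 (volume.restrict Ω) (1 : ℝ)‖ * ‖f - g‖ := by
  have hA' : NullMeasurableSet A (volume.restrict Ω) :=
    hA.mono_ac Measure.restrict_le_self.absolutelyContinuous
  have hi : ∀ f : L2 Ω ℝ, Integrable (fun x => |A.indicator f x|) (volume.restrict Ω) :=
    fun f => ((L2_integrable f).indicator₀ hA').abs
  rw [l1NormOn, l1NormOn, ← integral_sub (hi f) (hi g)]
  refine (abs_integral_le_integral_abs).trans (le_trans ?_ (L2_integral_abs_le (f - g)))
  refine integral_mono_ae ((hi f).sub (hi g)).abs (L2_integrable (f - g)).abs ?_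
  filter_upwards [Lp.coeFn_sub f g] with x hx
  rw [hx, Pi.sub_apply]
  by_cases h : x ∈ A
  · simpa [h] using abs_abs_sub_abs_le (f x) (g x)
  · simp [h]

lemma l1NormOn_le {A : Set (EuclideanSpace ℝ (Fin d))} (hA : NullMeasurableSet A volume)
    (f : L2 Ω ℝ) :
    l1NormOn Ω A f ≤ ‖Lp.const 2 (volume.restrict Ω) (1 : ℝ)‖ * ‖f‖ := by
  have := abs_l1NormOn_sub_le hA f 0
  rw [l1NormOn_zero, sub_zero, sub_zero] at this
  exact (le_abs_self _).trans this

/-- The hypothesis sees only finite sums; replacing the truncation of `f` by `f` costs the `L²` norm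
of the remainder. -/
lemma SpectralInequality.sum_sq_le {A : Set (EuclideanSpace ℝ (Fin d))} {lam : ℕ → ℝ}
    {e : HilbertBasis ℕ ℝ (L2 Ω ℝ)} {D : ℝ} (h : SpectralInequality Ω A lam e D) (hD : 0 ≤ D)
    (hA : NullMeasurableSet A volume) {Λ : ℝ} {k : ℕ} (hk : ∀ i < k, lam i < Λ) (f : L2 Ω ℝ) :
    ∑ i ∈ Finset.range k, inner ℝ (e i) f ^ 2 ≤ D * Real.exp (D * √Λ) *
      (l1NormOn Ω A f + ‖Lp.const 2 (volume.restrict Ω) (1 : ℝ)‖ *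
        ‖f - ∑ i ∈ Finset.range k, inner ℝ (e i) f • e i‖) ^ 2 := by
  -- For `k = 0` nothing guarantees `lam 0 < Λ`, which the spectral inequality requires.
  rcases Nat.eq_zero_or_pos k with rfl | hk0
  · simp; positivity
  refine (h Λ (hk 0 hk0) k (fun i hi => (hk i hi).le) fun i => inner ℝ (e i) f).trans ?_
  rw [← l1NormOn_congr_ae (coeFn_sum_smul (fun i => e i) (fun i => inner ℝ (e i) f) k)]
  gcongr
  · exact l1NormOn_nonneg _ _ _
  have := abs_l1NormOn_sub_le hA (∑ i ∈ Finset.range k, inner ℝ (e i) f • e i) f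
  rw [norm_sub_rev] at this
  linarith [(abs_le.1 this).2]

/-- The observation of a continuous path in `L²(Ω)` is integrable in time. -/
lemma integrableOn_l1NormOn (e : HilbertBasis ℕ ℝ (L2 Ω ℝ)) {T : ℝ}
    {𝒟 : ℝ → Set (EuclideanSpace ℝ (Fin d))}
    (hmeas : ∀ᵐ t ∂(volume.restrict (Ioo 0 T)), NullMeasurableSet (𝒟 t) volume)
    (hint : ∀ f : EuclideanSpace ℝ (Fin d) × ℝ → ℝ, IntegrableOn f (Ω ×ˢ Ioo 0 T) volume →
      IntegrableOn (fun t => l1NormOn Ω (𝒟 t) (fun x => f (x, t))) (Ioo 0 T) volume)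
    {u : ℝ → L2 Ω ℝ} (hu : ContinuousOn u (Ici 0)) :
    IntegrableOn (fun t => l1NormOn Ω (𝒟 t) (u t)) (Ioo 0 T) volume := by
  have hcont : ∀ {g : ℝ → ℝ}, ContinuousOn g (Ici 0) → IntegrableOn g (Ioo 0 T) := fun hg =>
    ((hg.mono Icc_subset_Ici_self).integrableOn_compact isCompact_Icc).mono_set Ioo_subset_Icc_self
  -- `hint` concerns functions of `(x, t)` jointly. The partial sums are such functions, being sums
  -- of products, and the observation inherits measurability as their limit; integrability comes
  -- from `hbound`.
  set F : ℕ → ℝ → ℝ := fun n t => l1NormOn Ω (𝒟 t)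
    (fun x => ∑ i ∈ Finset.range n, inner ℝ (e i) (u t) * (e i : L2 Ω ℝ) x)
  have hF : ∀ n, AEStronglyMeasurable (F n) (volume.restrict (Ioo 0 T)) := fun n => by
    refine (hint (fun p => ∑ i ∈ Finset.range n, inner ℝ (e i) (u p.2) * (e i : L2 Ω ℝ) p.1) ?_).1
    rw [IntegrableOn, Measure.volume_eq_prod, ← Measure.prod_restrict]
    refine integrable_finsetSum _ fun i _ => ?_
    have h1 : IntegrableOn (fun t => inner ℝ (e i) (u t)) (Ioo 0 T) :=
      hcont (continuousOn_const.inner hu)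
    exact ((L2_integrable (e i)).mul_prod h1).congr (.of_forall fun p => mul_comm _ _)
  have hlim : ∀ᵐ t ∂(volume.restrict (Ioo 0 T)),
      Tendsto (fun n => F n t) atTop (𝓝 (l1NormOn Ω (𝒟 t) (u t))) := by
    filter_upwards [hmeas] with t ht
    have hP : Tendsto (fun n => ∑ i ∈ Finset.range n, inner ℝ (e i) (u t) • e i) atTop
        (𝓝 (u t)) := by
      have := (e.hasSum_repr (u t)).tendsto_sum_nat
      simpa only [e.repr_apply_apply] using this
    rw [tendsto_iff_norm_sub_tendsto_zero] at hP ⊢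
    have hP' := hP.const_mul ‖Lp.const 2 (volume.restrict Ω) (1 : ℝ)‖
    rw [mul_zero] at hP'
    refine squeeze_zero (fun n => norm_nonneg _) (fun n => ?_) hP'
    simp only [F]
    rw [← l1NormOn_congr_ae (coeFn_sum_smul (fun i => e i) (fun i => inner ℝ (e i) (u t)) n)]
    exact abs_l1NormOn_sub_le ht _ _
  have hbound : Integrable (fun t => ‖Lp.const 2 (volume.restrict Ω) (1 : ℝ)‖ * ‖u t‖)
      (volume.restrict (Ioo 0 T)) := hcont (continuousOn_const.mul hu.norm)
  refine hbound.mono' (aestronglyMeasurable_of_tendsto_ae atTop hF hlim) ?_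
  filter_upwards [hmeas] with t ht
  rw [Real.norm_eq_abs, abs_of_nonneg (l1NormOn_nonneg _ _ _)]
  exact l1NormOn_le ht _

end observation

/-! ### Time averages of a damped mode -/

lemma exists_abs_cos_add_sin_eq {b : ℝ} (hb : b ≠ 0) (x y : ℝ) : ∃ φ, ∀ s,
    |Real.cos (b * s) * x + Real.sin (b * s) * y| =
      √(x ^ 2 + y ^ 2) * |Real.cos (|b| * s - φ)| := by
  rcases lt_or_gt_of_ne hb with hb | hb
  · obtain ⟨φ, hφ⟩ := exists_phase x (-y)
    refine ⟨φ, fun s => ?_⟩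
    rw [abs_of_neg hb, ← abs_of_nonneg (Real.sqrt_nonneg (x ^ 2 + y ^ 2)), ← abs_mul,
      ← neg_sq y, ← hφ, neg_mul, Real.cos_neg, Real.sin_neg]
    ring_nf
  · obtain ⟨φ, hφ⟩ := exists_phase x y
    refine ⟨φ, fun s => ?_⟩
    rw [abs_of_pos hb, ← abs_of_nonneg (Real.sqrt_nonneg (x ^ 2 + y ^ 2)), ← abs_mul, ← hφ]
    ring_nf

/-- A damped oscillation is bounded from below in mean over a set of times of positive measure. -/
lemma le_setIntegral_abs_damped {a b l l₀ α β : ℝ} (ha : 0 ≤ a) (hb : b ≠ 0) (hl₀ : 0 < l₀)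
    (hl : l₀ ≤ l) (hαβ : α < β) {F : Set ℝ} (hF : NullMeasurableSet F) (hFs : F ⊆ Icc α β)
    (x y : ℝ) :
    volume.real F ^ 2 / (4 * (β - α + 2 * Real.pi / (|b| * l₀))) *
        (Real.exp (-(a * l) * β) * √(x ^ 2 + y ^ 2)) ≤
      ∫ t in F, |Real.exp (-(a * l) * t) *
        (Real.cos (b * l * t) * x + Real.sin (b * l * t) * y)| := by
  have hb' : 0 < |b| := abs_pos.2 hb
  obtain ⟨φ, hφ⟩ := exists_abs_cos_add_sin_eq hb x y
  have h1 := le_setIntegral_abs_cos (φ := φ) (mul_pos hb' hl₀)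
    (mul_le_mul_of_nonneg_left hl hb'.le) hαβ hF hFs
  set A := Real.exp (-(a * l) * β) * √(x ^ 2 + y ^ 2) with hA
  have hA0 : 0 ≤ A := by positivity
  have hint : ∀ {g : ℝ → ℝ}, Continuous g → IntegrableOn g F := fun hg =>
    (hg.continuousOn.integrableOn_compact isCompact_Icc).mono_set hFs
  refine (mul_le_mul_of_nonneg_right h1 hA0).trans ?_
  rw [← integral_mul_const]
  refine setIntegral_mono_on₀ (hint (by fun_prop)) (hint (by fun_prop)) hF fun t ht => ?_
  rw [abs_mul, abs_of_pos (Real.exp_pos _), mul_assoc b, mul_assoc |b|, hφ, hA]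
  have hexp : Real.exp (-(a * l) * β) ≤ Real.exp (-(a * l) * t) := by
    refine Real.exp_le_exp.2 ?_
    have h2 : 0 ≤ a * l := mul_nonneg ha (hl₀.le.trans hl)
    nlinarith [(hFs ht).2]
  calc _ = Real.exp (-(a * l) * β) * (√(x ^ 2 + y ^ 2) * |Real.cos (|b| * (l * t) - φ)|) := by ring
    _ ≤ _ := by gcongr

/-! ### Low-frequency observability -/

section observability

variable {d : ℕ} {Ω : Set (EuclideanSpace ℝ (Fin d))} {a b : ℝ} {lam : ℕ → ℝ}
  {e : HilbertBasis ℕ ℝ (L2 Ω ℝ)}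
  {S : ℝ → L2 Ω (EuclideanSpace ℝ (Fin 2)) →L[ℝ] L2 Ω (EuclideanSpace ℝ (Fin 2))}

/-- The initial energy in the `i`-th eigenmode. -/
noncomputable def modeEnergy (e : HilbertBasis ℕ ℝ (L2 Ω ℝ))
    (z : L2 Ω (EuclideanSpace ℝ (Fin 2))) (i : ℕ) : ℝ :=
  inner ℝ (e i) (component 0 z) ^ 2 + inner ℝ (e i) (component 1 z) ^ 2

lemma modeEnergy_nonneg (z : L2 Ω (EuclideanSpace ℝ (Fin 2))) (i : ℕ) : 0 ≤ modeEnergy e z i := by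
  unfold modeEnergy; positivity

lemma hasSum_modeEnergy (z : L2 Ω (EuclideanSpace ℝ (Fin 2))) :
    HasSum (modeEnergy e z) (‖z‖ ^ 2) := by
  rw [norm_sq_eq_component]
  exact (e.hasSum_inner_sq _).add (e.hasSum_inner_sq _)

/-- The rotation preserves the energy of the mode, so only the damping remains. -/
lemma IsDirichletEigenbasis.modeEnergy_semigroup (h : IsDirichletEigenbasis Ω lam e)
    (hS : IsSemigroupGeneratedBy S (CoupledOperator Ω a b)) {t : ℝ} (ht : 0 ≤ t)
    (z : L2 Ω (EuclideanSpace ℝ (Fin 2))) (i : ℕ) :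
    modeEnergy e (S t z) i = Real.exp (-(2 * a * lam i * t)) * modeEnergy e z i := by
  obtain ⟨h0, h1⟩ := h.inner_component_semigroup hS ht z i
  have hexp : Real.exp (-(2 * a * lam i * t)) = Real.exp (-(a * lam i) * t) ^ 2 := by
    rw [← Real.exp_nat_mul]; congr 1; push_cast; ring
  rw [modeEnergy, modeEnergy, h0, h1, hexp]
  linear_combination (Real.exp (-(a * lam i) * t) ^ 2 *
    (inner ℝ (e i) (component 0 z) ^ 2 + inner ℝ (e i) (component 1 z) ^ 2)) *
    Real.sin_sq_add_cos_sq (b * lam i * t)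

lemma IsDirichletEigenbasis.norm_semigroup_le (h : IsDirichletEigenbasis Ω lam e)
    (hS : IsSemigroupGeneratedBy S (CoupledOperator Ω a b)) (ha : 0 ≤ a) (hlam : ∀ i, 0 ≤ lam i)
    {t : ℝ} (ht : 0 ≤ t) (z : L2 Ω (EuclideanSpace ℝ (Fin 2))) : ‖S t z‖ ≤ ‖z‖ := by
  refine le_of_sq_le_sq ?_ (norm_nonneg _)
  refine hasSum_le (fun i => ?_) (hasSum_modeEnergy (e := e) (S t z)) (hasSum_modeEnergy (e := e) z)
  rw [h.modeEnergy_semigroup hS ht]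
  refine mul_le_of_le_one_left (modeEnergy_nonneg _ _) (Real.exp_le_one_iff.2 ?_)
  have := hlam i
  have : 0 ≤ 2 * a * lam i * t := by positivity
  linarith

/-- Observability of the final state up to the dissipated high frequencies. -/
lemma IsDirichletEigenbasis.norm_semigroup_le_of_frequency
    [IsFiniteMeasure (volume.restrict Ω)] (h : IsDirichletEigenbasis Ω lam e)
    (hS : IsSemigroupGeneratedBy S (CoupledOperator Ω a b)) (ha : 0 < a) (hb : b ≠ 0)
    {l₀ : ℝ} (hl₀ : 0 < l₀) (hlam : ∀ i, l₀ ≤ lam i) {D : ℝ} (hD : 0 ≤ D)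
    {S₁ S₂ : ℝ} (hS₁ : 0 < S₁) (hS₁₂ : S₁ < S₂) {F : Set ℝ} (hF : NullMeasurableSet F)
    (hFs : F ⊆ Icc S₁ S₂) (hF0 : 0 < volume.real F) {𝒟 : ℝ → Set (EuclideanSpace ℝ (Fin d))}
    (h𝒟 : ∀ᵐ t ∂volume, t ∈ F →
      NullMeasurableSet (𝒟 t) volume ∧ SpectralInequality Ω (𝒟 t) lam e D)
    {z : L2 Ω (EuclideanSpace ℝ (Fin 2))} (hz : z ≠ 0)
    (hobs : IntegrableOn (fun t => l1NormOn Ω (𝒟 t) (component 0 (S t z))) F) {Λ : ℝ} :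
    ‖S S₂ z‖ ≤ 4 * (S₂ - S₁ + 2 * Real.pi / (|b| * l₀)) / volume.real F *
        √(D * Real.exp (D * √Λ)) *
        (1 / volume.real F * (∫ t in F, l1NormOn Ω (𝒟 t) (component 0 (S t z))) +
          ‖Lp.const 2 (volume.restrict Ω) (1 : ℝ)‖ * (Real.exp (-(a * Λ * S₁)) * ‖z‖)) +
      Real.exp (-(a * Λ * S₁)) * ‖z‖ := by
  have hlam0 : ∀ i, 0 ≤ lam i := fun i => hl₀.le.trans (hlam i)
  have hzpos : 0 < ‖z‖ ^ 2 := by have := norm_pos_iff.2 hz; positivity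
  set δ := Real.exp (-(a * Λ * S₁)) * ‖z‖ with hδ
  have hδ0 : 0 ≤ δ := by positivity
  have hδsq : Real.exp (-(2 * a * Λ * S₁)) * ‖z‖ ^ 2 = δ ^ 2 := by
    rw [hδ, mul_pow, ← Real.exp_nat_mul]; congr 2; push_cast; ring
  set m := volume.real F
  set C := ‖Lp.const 2 (volume.restrict Ω) (1 : ℝ)‖
  set L := S₂ - S₁ + 2 * Real.pi / (|b| * l₀) with hL
  have hL0 : 0 < L := by
    have : 0 < 2 * Real.pi / (|b| * l₀) := by
      have := abs_pos.2 hb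
      have := Real.pi_pos
      positivity
    linarith
  set Q := √(D * Real.exp (D * √Λ)) with hQ
  obtain ⟨k, hk, htail⟩ := exists_cutoff (Λ := Λ) h.monotone hlam0 ha.le hS₁.le
    (modeEnergy_nonneg (e := e) z) (hasSum_modeEnergy z) hzpos
  rw [hδsq] at htail
  have hdecay : ∀ t, S₁ ≤ t → ∀ i,
      modeEnergy e (S t z) i ≤ Real.exp (-(2 * a * lam i * S₁)) * modeEnergy e z i := by
    intro t ht i
    rw [h.modeEnergy_semigroup hS (hS₁.le.trans ht)]
    have := hlam0 i
    have := modeEnergy_nonneg (e := e) z i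
    gcongr
  set ρ : ℕ → ℝ := fun i => √(modeEnergy e (S S₂ z) i)
  set R := √(∑ i ∈ Finset.range k, modeEnergy e (S S₂ z) i)
  have hR2 : R ^ 2 = ∑ i ∈ Finset.range k, modeEnergy e (S S₂ z) i :=
    Real.sq_sqrt (Finset.sum_nonneg fun i _ => modeEnergy_nonneg _ _)
  have hR0 : 0 ≤ R := Real.sqrt_nonneg _
  -- Orthogonality of low and high modes: `‖S S₂ z‖² ≤ R² + δ² ≤ (R + δ)²`.
  have hfinal : ‖S S₂ z‖ ≤ R + δ := by
    have h1 := htail _ _ (hasSum_modeEnergy (S S₂ z)) (hdecay S₂ hS₁₂.le)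
    rw [← hR2] at h1
    refine le_of_sq_le_sq ?_ (by positivity)
    nlinarith [mul_nonneg hR0 hδ0]
  let c : ℕ → ℝ → ℝ := fun i t => inner ℝ (e i) (component 0 (S t z))
  -- The weights `ρᵢ` do not depend on `t`. Cauchy–Schwarz in `i` produces the `ℓ²` norm of the
  -- observed coefficients with no factor `k`.
  have hpoint : ∀ᵐ t ∂(volume.restrict F), ∑ i ∈ Finset.range k, ρ i * |c i t| ≤
      R * (Q * (l1NormOn Ω (𝒟 t) (component 0 (S t z)) + C * δ)) := by
    rw [ae_restrict_iff'₀ hF]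
    filter_upwards [h𝒟] with t ht htF
    obtain ⟨hmeas, hspec⟩ := ht htF
    have htS : S₁ ≤ t := (hFs htF).1
    have hrem : ‖component 0 (S t z) - ∑ i ∈ Finset.range k,
        inner ℝ (e i) (component 0 (S t z)) • e i‖ ≤ δ := by
      refine le_of_sq_le_sq ?_ hδ0
      rw [e.norm_sub_sum_sq]
      refine htail _ _ (e.hasSum_inner_sq _) fun i => le_trans ?_ (hdecay t htS i)
      exact le_add_of_nonneg_right (sq_nonneg _)
    have hlow := hspec.sum_sq_le hD hmeas hk (component 0 (S t z))
    have hsqrt : √(∑ i ∈ Finset.range k, |c i t| ^ 2) ≤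
        Q * (l1NormOn Ω (𝒟 t) (component 0 (S t z)) + C * δ) := by
      have hnn := l1NormOn_nonneg Ω (𝒟 t) (component 0 (S t z))
      simp only [sq_abs]
      refine (Real.sqrt_le_sqrt hlow).trans ?_
      rw [Real.sqrt_mul' _ (sq_nonneg _), Real.sqrt_sq (by positivity)]
      gcongr
    refine (Real.sum_mul_le_sqrt_mul_sqrt _ _ _).trans ?_
    have hρ : ∑ i ∈ Finset.range k, ρ i ^ 2 = ∑ i ∈ Finset.range k, modeEnergy e (S S₂ z) i :=
      Finset.sum_congr rfl fun i _ => Real.sq_sqrt (modeEnergy_nonneg _ _)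
    rw [hρ]
    exact mul_le_mul_of_nonneg_left hsqrt hR0
  have hcF : ∀ i, ∀ t ∈ F, c i t = Real.exp (-(a * lam i) * t) *
      (Real.cos (b * lam i * t) * inner ℝ (e i) (component 0 z) +
        Real.sin (b * lam i * t) * inner ℝ (e i) (component 1 z)) := fun i t ht =>
    (h.inner_component_semigroup hS (hS₁.le.trans (hFs ht).1) z i).1
  have hρ : ∀ i, ρ i = Real.exp (-(a * lam i) * S₂) *
      √(inner ℝ (e i) (component 0 z) ^ 2 + inner ℝ (e i) (component 1 z) ^ 2) := fun i => by
    simp only [ρ]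
    rw [h.modeEnergy_semigroup hS (hS₁.trans hS₁₂).le, Real.sqrt_mul (Real.exp_pos _).le, modeEnergy,
      ← Real.exp_half]
    congr 2; ring
  have hcae : ∀ i, (fun t => |c i t|) =ᵐ[volume.restrict F] fun t => |Real.exp (-(a * lam i) * t) *
      (Real.cos (b * lam i * t) * inner ℝ (e i) (component 0 z) +
        Real.sin (b * lam i * t) * inner ℝ (e i) (component 1 z))| := fun i => by
    filter_upwards [ae_restrict_mem₀ hF] with t ht
    rw [hcF i t ht]
  have hcint : ∀ i, IntegrableOn (fun t => |c i t|) F := fun i => by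
    refine Integrable.congr ?_ (hcae i).symm
    have hcont : Continuous fun t => |Real.exp (-(a * lam i) * t) *
      (Real.cos (b * lam i * t) * inner ℝ (e i) (component 0 z) +
        Real.sin (b * lam i * t) * inner ℝ (e i) (component 1 z))| := by fun_prop
    exact (hcont.continuousOn.integrableOn_compact isCompact_Icc).mono_set hFs
  have hlower : ∀ i, m ^ 2 / (4 * L) * ρ i ≤ ∫ t in F, |c i t| := fun i => by
    rw [integral_congr_ae (hcae i), hρ]
    exact le_setIntegral_abs_damped ha.le hb hl₀ (hlam i) hS₁₂ hF hFs _ _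
  have hFfin : volume F ≠ ⊤ := ((measure_mono hFs).trans_lt (by simp)).ne
  have hconst : IntegrableOn (fun _ : ℝ => C * δ) F := integrableOn_const hFfin
  set I := ∫ t in F, l1NormOn Ω (𝒟 t) (component 0 (S t z))
  -- One factor `ρᵢ` is bounded by the time integral of `|cᵢ|`; the other stays as a weight for
  -- `hpoint`.
  have hkey : m ^ 2 / (4 * L) * R ^ 2 ≤ R * (Q * (I + m * (C * δ))) := by
    calc m ^ 2 / (4 * L) * R ^ 2
        = ∑ i ∈ Finset.range k, ρ i * (m ^ 2 / (4 * L) * ρ i) := by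
          rw [hR2, Finset.mul_sum]
          refine Finset.sum_congr rfl fun i _ => ?_
          rw [← Real.sq_sqrt (modeEnergy_nonneg (e := e) (S S₂ z) i)]
          ring
      _ ≤ ∑ i ∈ Finset.range k, ρ i * ∫ t in F, |c i t| :=
          Finset.sum_le_sum fun i _ => mul_le_mul_of_nonneg_left (hlower i) (Real.sqrt_nonneg _)
      _ = ∫ t in F, ∑ i ∈ Finset.range k, ρ i * |c i t| := by
          rw [integral_finsetSum _ fun i _ => (hcint i).const_mul _]
          simp only [integral_const_mul]
      _ ≤ ∫ t in F, R * (Q * (l1NormOn Ω (𝒟 t) (component 0 (S t z)) + C * δ)) :=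
          integral_mono_ae (integrable_finsetSum _ fun i _ => (hcint i).const_mul _)
            (((hobs.add hconst).const_mul _).const_mul _) hpoint
      _ = _ := by
          rw [integral_const_mul, integral_const_mul, integral_add hobs hconst, setIntegral_const,
            smul_eq_mul]
  have hI0 : 0 ≤ I := integral_nonneg fun t => l1NormOn_nonneg _ _ _
  have hQ0 : 0 ≤ Q := Real.sqrt_nonneg _
  have hRle : R ≤ 4 * L / m * Q * (1 / m * I + C * δ) := by
    have hrhs : 4 * L / m * Q * (1 / m * I + C * δ) =
        (Q * (I + m * (C * δ))) / (m ^ 2 / (4 * L)) := by field_simp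
    rw [hrhs, le_div_iff₀ (by positivity)]
    rcases hR0.eq_or_lt with hR | hR
    · rw [← hR, zero_mul]; positivity
    · refine le_of_mul_le_mul_left ?_ hR
      linarith
  linarith

end observability

/-! ### Absorption of constants and conclusion -/

/-- Absorbing the polynomial prefactors into the exponential cost. -/
lemma cost_le {G c₀ γ m s₁ s₂ θ : ℝ} (hG : 0 ≤ G) (hc₀ : 0 ≤ c₀) (hγ : 0 ≤ γ) (hm : 0 < m)
    (hms : m ≤ s₂) (hs₁ : 0 < s₁) (hθ : θ ∈ Ioo (0 : ℝ) 1) :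
    2 * (4 * (s₂ + c₀) / m * G) * Real.exp (γ / (θ * s₁)) ≤
      (8 * (1 + c₀) * G + 3 + γ) *
        Real.exp ((8 * (1 + c₀) * G + 3 + γ) * (s₂ / (1 - θ) + 1 / (θ * s₁))) / m ^ 3 := by
  obtain ⟨hθ0, hθ1⟩ := hθ
  have hs₂ : 0 < s₂ := hm.trans_le hms
  set M := 8 * (1 + c₀) * G + 3 + γ with hM
  have hG' : 0 ≤ 8 * (1 + c₀) * G := by positivity
  -- Only `1 / m` is present; passing to `1 / m ^ 3` leaves a factor `m ^ 2 ≤ (1 + s₂) ^ 2`, which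
  -- `exp (3 s₂)` absorbs together with `s₂ + c₀`.
  have hpoly : (s₂ + c₀) * m ^ 2 ≤ (1 + c₀) * Real.exp (3 * s₂) := by
    have h1 : 1 + s₂ ≤ Real.exp s₂ := by linarith [Real.add_one_le_exp s₂]
    calc (s₂ + c₀) * m ^ 2 ≤ ((1 + c₀) * (1 + s₂)) * (1 + s₂) ^ 2 := by
          gcongr
          · nlinarith
          · linarith
      _ = (1 + c₀) * (1 + s₂) ^ 3 := by ring
      _ ≤ (1 + c₀) * Real.exp s₂ ^ 3 := by gcongr
      _ = _ := by rw [← Real.exp_nat_mul]; norm_num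
  have hexp : Real.exp (3 * s₂) * Real.exp (γ / (θ * s₁)) ≤
      Real.exp (M * (s₂ / (1 - θ) + 1 / (θ * s₁))) := by
    rw [← Real.exp_add, mul_add]
    refine Real.exp_le_exp.2 (add_le_add ?_ ?_)
    · have h1 : s₂ ≤ s₂ / (1 - θ) := by
        rw [le_div_iff₀ (by linarith)]; nlinarith
      exact mul_le_mul (by linarith) h1 hs₂.le (by linarith)
    · rw [mul_one_div]
      gcongr
      linarith
  calc 2 * (4 * (s₂ + c₀) / m * G) * Real.exp (γ / (θ * s₁))
      = 8 * G * ((s₂ + c₀) * m ^ 2) * Real.exp (γ / (θ * s₁)) / m ^ 3 := by field_simp; ring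
    _ ≤ 8 * G * ((1 + c₀) * Real.exp (3 * s₂)) * Real.exp (γ / (θ * s₁)) / m ^ 3 := by gcongr
    _ = 8 * (1 + c₀) * G * (Real.exp (3 * s₂) * Real.exp (γ / (θ * s₁))) / m ^ 3 := by ring
    _ ≤ _ := by
      gcongr
      linarith

theorem theorem3p1 {d : ℕ} (hd : 0 < d) (Ω : Set (EuclideanSpace ℝ (Fin d)))
    (hΩ_open : IsOpen Ω) (hΩ_conn : IsConnected Ω) (hΩ_bdd : Bornology.IsBounded Ω)
    (a b : ℝ) (ha : 0 < a) (hb : b ≠ 0) (D : ℝ) (hD : 0 < D) :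
    ∃ M : ℝ, 0 < M ∧
      ∀ (lam : ℕ → ℝ) (e : HilbertBasis ℕ ℝ (L2 Ω ℝ)), IsDirichletEigenbasis Ω lam e →
      ∀ S : ℝ → L2 Ω (EuclideanSpace ℝ (Fin 2)) →L[ℝ] L2 Ω (EuclideanSpace ℝ (Fin 2)),
        IsSemigroupGeneratedBy S (CoupledOperator Ω a b) →
      ∀ (T : ℝ) (E : Set ℝ) (𝒟 : ℝ → Set (EuclideanSpace ℝ (Fin d))),
        0 < T → E ⊆ Ioo 0 T → NullMeasurableSet E volume → 0 < volume E →
        (∀ t ∈ Ioo 0 T, 𝒟 t ⊆ Ω) →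
        (∀ᵐ t ∂(volume.restrict (Ioo 0 T)), NullMeasurableSet (𝒟 t) volume) →
        (∀ f : EuclideanSpace ℝ (Fin d) × ℝ → ℝ, IntegrableOn f (Ω ×ˢ Ioo 0 T) volume →
          IntegrableOn (fun t => l1NormOn Ω (𝒟 t) (fun x => f (x, t))) (Ioo 0 T) volume) →
        (∀ᵐ t ∂volume, t ∈ E → SpectralInequality Ω (𝒟 t) lam e D) →
      ∀ θ ∈ Ioo (0 : ℝ) 1, ∀ S₁ S₂ : ℝ, 0 < S₁ → S₁ < S₂ → S₂ ≤ T →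
        0 < volume (E ∩ Icc S₁ S₂) →
      ∀ z : L2 Ω (EuclideanSpace ℝ (Fin 2)),
        IntervalIntegrable
          (E.indicator fun t => l1NormOn Ω (𝒟 t) (component 0 (S t z))) volume S₁ S₂ ∧
        ‖S S₂ z‖ ≤
          M * Real.exp (M * (S₂ / (1 - θ) + 1 / (θ * S₁))) / volume.real (E ∩ Icc S₁ S₂) ^ 3 *
            (1 / volume.real (E ∩ Icc S₁ S₂) *
              ∫ t in S₁..S₂,
                E.indicator (fun t => l1NormOn Ω (𝒟 t) (component 0 (S t z))) t) ^ (1 - θ) *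
            ‖z‖ ^ θ := by
  obtain ⟨r, hr0, hr⟩ := hΩ_bdd.subset_closedBall_lt 0 0
  have : IsFiniteMeasure (volume.restrict Ω) := ⟨by simpa using hΩ_bdd.measure_lt_top⟩
  set l₀ : ℝ := 1 / (4 * r ^ 2)
  have hl₀ : 0 < l₀ := by positivity
  set C := ‖Lp.const 2 (volume.restrict Ω) (1 : ℝ)‖
  set c₀ := 2 * Real.pi / (|b| * l₀)
  have hc₀ : 0 ≤ c₀ := by have := Real.pi_pos; positivity
  -- `1 + C` pays for the truncation error in the observation, and the final `+ 1` for the bare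
  -- high-frequency remainder.
  set G := √D * (1 + C) + 1 with hG
  have hG1 : 1 ≤ G := le_add_of_nonneg_left (by positivity)
  -- The rate is `D / 2`, since the spectral inequality bounds a square.
  set γ := (D / 2) ^ 2 / (4 * a)
  have hγ : 0 ≤ γ := by positivity
  refine ⟨8 * (1 + c₀) * G + 3 + γ, by positivity, ?_⟩
  intro lam e he S hS T E 𝒟 _ hE hEm _ _ hmeas hint hspec θ hθ S₁ S₂ hS₁ hS₁₂ hS₂T hvol z
  have hlam : ∀ i, l₀ ≤ lam i := fun i => he.inv_le_lam hd hr0 hr i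
  have hlam0 : ∀ i, 0 ≤ lam i := fun i => hl₀.le.trans (hlam i)
  have hS₂ : 0 < S₂ := hS₁.trans hS₁₂
  have hobs : IntegrableOn (fun t => l1NormOn Ω (𝒟 t) (component 0 (S t z))) (Ioo 0 T) :=
    integrableOn_l1NormOn e hmeas hint
      ((componentL Ω 0).continuous.comp_continuousOn (hS.continuousOn z))
  have hind : Integrable (E.indicator fun t => l1NormOn Ω (𝒟 t) (component 0 (S t z))) :=
    (hobs.mono_set hE).integrable_indicator₀ hEm
  refine ⟨hind.intervalIntegrable, ?_⟩
  set F := E ∩ Icc S₁ S₂ with hFdef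
  have hF : NullMeasurableSet F := hEm.inter measurableSet_Icc.nullMeasurableSet
  have hFfin : volume F ≠ ⊤ := ((measure_mono inter_subset_right).trans_lt (by simp)).ne
  have hm : 0 < volume.real F := ENNReal.toReal_pos hvol.ne' hFfin
  have hmS : volume.real F ≤ S₂ := by
    have : volume.real F ≤ volume.real (Icc S₁ S₂) :=
      measureReal_mono inter_subset_right (by simp)
    rw [Real.volume_real_Icc_of_le hS₁₂.le] at this
    linarith
  have hintegral : ∫ t in S₁..S₂, E.indicator
      (fun t => l1NormOn Ω (𝒟 t) (component 0 (S t z))) t =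
      ∫ t in F, l1NormOn Ω (𝒟 t) (component 0 (S t z)) := by
    rw [intervalIntegral.integral_of_le hS₁₂.le, ← integral_Icc_eq_integral_Ioc,
      integral_indicator₀ (hEm.mono_ac Measure.restrict_le_self.absolutelyContinuous),
      Measure.restrict_restrict₀ (hEm.mono_ac Measure.restrict_le_self.absolutelyContinuous)]
  rw [hintegral]
  set m := volume.real F
  set X := 1 / m * ∫ t in F, l1NormOn Ω (𝒟 t) (component 0 (S t z)) with hX
  have hX0 : 0 ≤ X := mul_nonneg (by positivity) (integral_nonneg fun t => l1NormOn_nonneg _ _ _)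
  rcases eq_or_ne z 0 with rfl | hz
  · simp [Real.zero_rpow hθ.1.ne']
  have hN : 0 < ‖z‖ := norm_pos_iff.2 hz
  have h𝒟 : ∀ᵐ t ∂volume, t ∈ F →
      NullMeasurableSet (𝒟 t) volume ∧ SpectralInequality Ω (𝒟 t) lam e D := by
    filter_upwards [(ae_restrict_iff' measurableSet_Ioo).1 hmeas, hspec] with t h1 h2 ht
    exact ⟨h1 (hE ht.1), h2 ht.1⟩
  set L := 4 * (S₂ + c₀) / m with hL
  -- This is where `m ≤ S₂` enters; it lets the bare remainder be absorbed and meets the requirement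
  -- `1 ≤ P` of the interpolation.
  have hL1 : 1 ≤ L := by
    rw [hL, le_div_iff₀ hm]; linarith
  have hfreq : ∀ Λ, 0 ≤ Λ → ‖S S₂ z‖ ≤
      L * G * Real.exp (D / 2 * √Λ) * (X + Real.exp (-(a * Λ * S₁)) * ‖z‖) := by
    intro Λ _
    refine (he.norm_semigroup_le_of_frequency hS ha hb hl₀ hlam hD.le hS₁ hS₁₂ hF
      inter_subset_right hm h𝒟 hz (hobs.mono_set (inter_subset_left.trans hE)) (Λ := Λ)).trans ?_
    set δ := Real.exp (-(a * Λ * S₁)) * ‖z‖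
    have hδ : 0 ≤ δ := by positivity
    have hsqrt : √(D * Real.exp (D * √Λ)) = √D * Real.exp (D / 2 * √Λ) := by
      rw [Real.sqrt_mul hD.le, ← Real.exp_half]; congr 2; ring
    rw [hsqrt, ← hX]
    have hexp : 1 ≤ Real.exp (D / 2 * √Λ) := Real.one_le_exp (by positivity)
    have hfac : 1 ≤ L * Real.exp (D / 2 * √Λ) := one_le_mul_of_one_le_of_one_le hL1 hexp
    have hC : 0 ≤ C := norm_nonneg _
    calc 4 * (S₂ - S₁ + c₀) / m * (√D * Real.exp (D / 2 * √Λ)) * (X + C * δ) + δ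
        ≤ L * (√D * Real.exp (D / 2 * √Λ)) * ((1 + C) * (X + δ)) +
          L * Real.exp (D / 2 * √Λ) * (X + δ) := by
          refine add_le_add ?_ ?_
          · have h1 : S₂ - S₁ + c₀ ≤ S₂ + c₀ := by linarith
            have h2 : X + C * δ ≤ (1 + C) * (X + δ) := by nlinarith [mul_nonneg hC hX0]
            rw [hL]
            gcongr
          · nlinarith
      _ = _ := by rw [hG]; ring
  have hinterp := le_rpow_mul_rpow_of_forall_frequency ha hS₁ hN hX0
    (one_le_mul_of_one_le_of_one_le hL1 hG1)
    (he.norm_semigroup_le hS ha.le hlam0 hS₂.le z) hθ hfreq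
  refine hinterp.trans ?_
  have hcost := cost_le (zero_le_one.trans hG1) hc₀ hγ hm hmS hS₁ hθ
  have hγ' : (D / 2) ^ 2 / (4 * a * θ * S₁) = γ / (θ * S₁) := by
    simp only [γ]; rw [div_div]; ring_nf
  rw [hγ']
  gcongr
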